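/- Let $0<k<1$ and $\rho_0>0$. Consider a static spherically symmetric solution of the Einstein--Euler equations $G_{\mu\nu}=8\pi T_{\mu\nu}$, $T_{\mu\nu}=(\rho+p)u_\mu u_\nu+p\,g_{\mu\nu}$, with linear equation of state $p=k^2\rho$, that is, a metric $$\mathbf g=-e^{2\nu(r)}\,dt^2+e^{2\lambda(r)}\,dr^2+r^2(d\theta^2+\sin^2\theta\,d\varphi^2),\qquad \nu,\lambda\in C^2((0,\infty)),$$ a density $\rho=\rho(r)$ and a unit timelike vector field $u$ satisfying these equations for all $r>0$, with regular center and central density $\rho_0$, that is, $\lambda(r)\to0$ and $\rho(r)\to\rho_0$ as $r\to0^+$. Let $m(r)=4\pi\int_0^r\rho(s)s^2\,ds$ be its mass function. Then there are $c>0$ and $h\in C^3((0,\infty))$ with $h(r)\to0$ as $r\to0^+$ such that in the coordinates $(v,r,\theta,\varphi)$ with $v=ct+h(r)$ the metric has the generalized Eddington--Finkelstein form $$\mathbf g=-a(r)b(r)^2\,dv^2+2b(r)\,dv\,dr+r^2(d\theta^2+\sin^2\theta\,d\varphi^2),\qquad a(r)=1-\frac{2m(r)}r,\quad b(r)>0,\quad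 \lim_{r\to0^+}b(r)=1.$$ With the conical deficit angle $\alpha=\frac{4k^2}{(1+k^2)^2+4k^2}$ one has $$\lim_{r\to\infty}a(r)=1-\alpha,\qquad \lim_{r\to\infty}r^{-\frac{2k^2}{1+k^2}}\,b(r)=\left(\frac{8\pi\rho_0}{\alpha}\right)^{\frac{k^2}{1+k^2}}\frac1{\sqrt{1-\alpha}}.$$ -/

import Mathlib

open Filter Topology Set

noncomputable section

namespace EinsteinEuler

/-! ### Tensor calculus in one coordinate chart -/

section Tensor

variable {ι : Type} [Fintype ι] [DecidableEq ι]

/-- The partial derivative of `f` in the `i`-th coordinate direction at `x`. -/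
def partialDeriv (i : ι) (f : (ι → ℝ) → ℝ) (x : ι → ℝ) : ℝ :=
  deriv (fun s => f (Function.update x i s)) (x i)

/-- Christoffel symbols `Γ^σ_{μν}` of the metric with components `g`. -/
def christoffel (g : (ι → ℝ) → Matrix ι ι ℝ) (x : ι → ℝ) (σ μ ν : ι) : ℝ :=
  1 / 2 * ∑ τ, (g x)⁻¹ σ τ *
    (partialDeriv μ (fun y => g y τ ν) x + partialDeriv ν (fun y => g y τ μ) x
      - partialDeriv τ (fun y => g y μ ν) x)

/-- Ricci curvature `R_{μν}` (positive on round spheres). -/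
def ricci (g : (ι → ℝ) → Matrix ι ι ℝ) (x : ι → ℝ) (μ ν : ι) : ℝ :=
  (∑ σ, (partialDeriv σ (fun y => christoffel g y σ μ ν) x
      - partialDeriv ν (fun y => christoffel g y σ μ σ) x))
    + ∑ σ, ∑ τ, (christoffel g x σ σ τ * christoffel g x τ μ ν
      - christoffel g x σ ν τ * christoffel g x τ μ σ)

/-- Scalar curvature. -/
def scalarCurvature (g : (ι → ℝ) → Matrix ι ι ℝ) (x : ι → ℝ) : ℝ :=
  ∑ μ, ∑ ν, (g x)⁻¹ μ ν * ricci g x μ ν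

/-- Einstein tensor `G_{μν} = R_{μν} - (1/2) R g_{μν}`. -/
def einsteinTensor (g : (ι → ℝ) → Matrix ι ι ℝ) (x : ι → ℝ) (μ ν : ι) : ℝ :=
  ricci g x μ ν - 1 / 2 * scalarCurvature g x * g x μ ν

/-- The covector `u_μ = g_{μν} u^ν` at the point `x`. -/
def lower (g : (ι → ℝ) → Matrix ι ι ℝ) (u : (ι → ℝ) → ι → ℝ) (x : ι → ℝ) (μ : ι) : ℝ :=
  ∑ ν, g x μ ν * u x ν

/-- Energy-momentum tensor `T_{μν} = (ρ + p) u_μ u_ν + p g_{μν}` of a perfect fluid with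
density `ρ`, pressure `p` and velocity vector field `u`. -/
def perfectFluid (g : (ι → ℝ) → Matrix ι ι ℝ) (ρ p : (ι → ℝ) → ℝ) (u : (ι → ℝ) → ι → ℝ)
    (x : ι → ℝ) (μ ν : ι) : ℝ :=
  (ρ x + p x) * lower g u x μ * lower g u x ν + p x * g x μ ν

/-- The pullback `(Φ^* G)_{μν} = ∂_μ Φ^α ∂_ν Φ^β G_{αβ} ∘ Φ`. -/
def pullback (Φ : (ι → ℝ) → ι → ℝ) (G : (ι → ℝ) → Matrix ι ι ℝ) (x : ι → ℝ) : Matrix ι ι ℝ :=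
  Matrix.of fun μ ν => ∑ α, ∑ β,
    partialDeriv μ (fun y => Φ y α) x * partialDeriv ν (fun y => Φ y β) x * G (Φ x) α β

end Tensor

/-! ### Static spherically symmetric solutions

The four coordinates are `x 0` (time `t`, or advanced time `v`), `x 1 = r` (area radius),
`x 2 = θ` and `x 3 = φ`. -/

/-- The coordinate domain `r > 0`, `0 < θ < π` (away from the center and the axis). -/
def chart : Set (Fin 4 → ℝ) := {x | 0 < x 1 ∧ 0 < x 2 ∧ x 2 < Real.pi}

/-- The general static spherically symmetric metric in area-radius coordinates,
`-e^{2ν(r)} dt² + e^{2λ(r)} dr² + r² (dθ² + sin² θ dφ²)`. -/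
def staticMetric (nu lam : ℝ → ℝ) (x : Fin 4 → ℝ) : Matrix (Fin 4) (Fin 4) ℝ :=
  Matrix.diagonal ![-Real.exp (2 * nu (x 1)), Real.exp (2 * lam (x 1)), x 1 ^ 2,
    x 1 ^ 2 * Real.sin (x 2) ^ 2]

/-- A static spherically symmetric solution `(nu, lam, ρ, u)`, of infinite extent, of the
Einstein-Euler equations with linear equation of state `p = k² ρ`, with regular center and central
density `ρ₀`. The fluid velocity `u` is an arbitrary unit timelike vector field. -/
structure IsStaticSolution (k ρ₀ : ℝ) (nu lam ρ : ℝ → ℝ) (u : (Fin 4 → ℝ) → Fin 4 → ℝ) :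
    Prop where
  contDiffOn_nu : ContDiffOn ℝ 2 nu (Ioi 0)
  contDiffOn_lam : ContDiffOn ℝ 2 lam (Ioi 0)
  unit_timelike : ∀ x ∈ chart, ∑ μ, lower (staticMetric nu lam) u x μ * u x μ = -1
  einstein : ∀ x ∈ chart, ∀ μ ν,
    einsteinTensor (staticMetric nu lam) x μ ν =
      8 * Real.pi * perfectFluid (staticMetric nu lam) (fun y => ρ (y 1))
        (fun y => k ^ 2 * ρ (y 1)) u x μ ν
  regular_center : Tendsto lam (𝓝[>] 0) (𝓝 0)
  central_density : Tendsto ρ (𝓝[>] 0) (𝓝 ρ₀)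

/-- The mass function `m(r) = ∫₀^r 4π s² ρ(s) ds`. -/
def massFunction (ρ : ℝ → ℝ) (r : ℝ) : ℝ :=
  ∫ s in (0 : ℝ)..r, 4 * Real.pi * s ^ 2 * ρ s

/-- The generalized Eddington-Finkelstein metric
`-a b² dv² + 2 b dv dr + r² (dθ² + sin² θ dφ²)` with `a = a(r)` and `b = b(r)`. -/
def efMetric (a b : ℝ → ℝ) (x : Fin 4 → ℝ) : Matrix (Fin 4) (Fin 4) ℝ :=
  !![-(a (x 1) * b (x 1) ^ 2), b (x 1), 0, 0;
     b (x 1), 0, 0, 0;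
     0, 0, x 1 ^ 2, 0;
     0, 0, 0, x 1 ^ 2 * Real.sin (x 2) ^ 2]

/-- The change of coordinates `(t, r, θ, φ) ↦ (v, r, θ, φ)` with `v = c t + h(r)`. -/
def toEF (c : ℝ) (h : ℝ → ℝ) (x : Fin 4 → ℝ) : Fin 4 → ℝ :=
  ![c * x 0 + h (x 1), x 1, x 2, x 3]

/-- The conical deficit angle `α = 4k² / ((1 + k²)² + 4k²)`. -/
def deficitAngle (k : ℝ) : ℝ := 4 * k ^ 2 / ((1 + k ^ 2) ^ 2 + 4 * k ^ 2)

end EinsteinEuler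

end

noncomputable section

namespace EinsteinEuler

/-! The Einstein tensor of the static metric is diagonal, which forces the fluid to be at rest and
leaves three radial equations (`field_equations`). Together they give the Euler equation `p' = -(ρ +
p) ν'`. As `p = k² ρ`, the product `ρ e^{σν}` with `σ = (1 + k²)/k²` is constant, so `ν` has a limit
`ν₀` at the center and `ρ` is an explicit function of `ν` (`exists_density_eq`). The `tt` equation
integrates to `e^{-2λ} = 1 - 2m/r`. Taking `a = e^{-2λ}`, `b = e^{ν+λ-ν₀}`, `c = e^{ν₀}` and `h' =
1/(ab)` puts the metric in the required form.

For the asymptotics put `κ = k²`, `s = log r`, `X = 2m/r`, `Y = 8πr²ρ`. The equations become an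
autonomous planar system with one equilibrium in the region `Y > 0`, at `X = Y = α`, where the slope
`t = rν'` equals `t* = 2κ/(1+κ)`. A logarithmic Lyapunov function decreases at a rate comparable to
`(t - t*)²` and confines each forward trajectory to a compact set away from `X = 1`. Hence `t → t*`
(`tendsto_zero_of_dissipation`). With `t` as input, `X` solves a stable linear equation up to a
vanishing error, so `X → α`, and then `Y → α`. The limit of `b` follows by inverting the density law
(`rpow_mul_exp_eq`). -/

/-! ### Curvature of the static metric -/

theorem staticMetric_inv (nu lam : ℝ → ℝ) {x : Fin 4 → ℝ} (hx : x ∈ chart) :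
    (staticMetric nu lam x)⁻¹ = Matrix.diagonal ![-(Real.exp (2 * nu (x 1)))⁻¹,
      (Real.exp (2 * lam (x 1)))⁻¹, (x 1 ^ 2)⁻¹, (x 1 ^ 2 * Real.sin (x 2) ^ 2)⁻¹] := by
  obtain ⟨h1, h2, h3⟩ := hx
  have hs : Real.sin (x 2) ≠ 0 := (Real.sin_pos_of_pos_of_lt_pi h2 h3).ne'
  apply Matrix.inv_eq_right_inv
  rw [staticMetric, Matrix.diagonal_mul_diagonal, ← Matrix.diagonal_one]
  congr 1
  funext i
  have h0 := h1.ne'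
  fin_cases i <;> simp [h0, Real.exp_ne_zero]
  field_simp

theorem partialDeriv_diagonal {ι : Type} [DecidableEq ι] (d : (ι → ℝ) → ι → ℝ)
    (i a b : ι) (x : ι → ℝ) :
    partialDeriv i (fun y => Matrix.diagonal (d y) a b) x =
      Matrix.diagonal (fun j => partialDeriv i (fun y => d y j) x) a b := by
  by_cases h : a = b
  · subst h; simp
  · simp [h, partialDeriv]

/-- Derivatives of the entries of the static metric. -/
theorem partialDeriv_staticMetric {nu lam : ℝ → ℝ} {x : Fin 4 → ℝ}
    (hn : DifferentiableAt ℝ nu (x 1)) (hl : DifferentiableAt ℝ lam (x 1)) (i a b : Fin 4) :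
    partialDeriv i (fun y => staticMetric nu lam y a b) x =
      Matrix.diagonal (![![0, 0, 0, 0],
        ![-(2 * deriv nu (x 1) * Real.exp (2 * nu (x 1))),
          2 * deriv lam (x 1) * Real.exp (2 * lam (x 1)), 2 * x 1,
          2 * x 1 * Real.sin (x 2) ^ 2],
        ![0, 0, 0, x 1 ^ 2 * (2 * Real.sin (x 2) * Real.cos (x 2))],
        ![0, 0, 0, 0]] i) a b := by
  unfold staticMetric
  rw [partialDeriv_diagonal]
  congr 2
  funext j
  have e1 : deriv (fun s => Real.exp (2 * nu s)) (x 1) =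
      2 * deriv nu (x 1) * Real.exp (2 * nu (x 1)) := by
    rw [((hn.hasDerivAt.const_mul 2).exp).deriv]; ring
  have e2 : deriv (fun s => Real.exp (2 * lam s)) (x 1) =
      2 * deriv lam (x 1) * Real.exp (2 * lam (x 1)) := by
    rw [((hl.hasDerivAt.const_mul 2).exp).deriv]; ring
  have e3 : deriv (fun s => Real.sin s ^ 2) (x 2) = 2 * Real.sin (x 2) * Real.cos (x 2) := by
    have := ((Real.hasDerivAt_sin (x 2)).fun_pow 2).deriv
    rw [this]; norm_num
  fin_cases i <;> fin_cases j <;> simp [partialDeriv, e1, e2, e3]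

/-- The Christoffel symbols of the static metric, as functions of `r` and `θ`. -/
def staticChristoffel (nu lam : ℝ → ℝ) (r θ : ℝ) : Fin 4 → Fin 4 → Fin 4 → ℝ
  | 0, 0, 1 => deriv nu r
  | 0, 1, 0 => deriv nu r
  | 1, 0, 0 => deriv nu r * Real.exp (2 * nu r - 2 * lam r)
  | 1, 1, 1 => deriv lam r
  | 1, 2, 2 => -(r * Real.exp (-(2 * lam r)))
  | 1, 3, 3 => -(r * Real.exp (-(2 * lam r)) * Real.sin θ ^ 2)
  | 2, 1, 2 => r⁻¹
  | 2, 2, 1 => r⁻¹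
  | 2, 3, 3 => -(Real.sin θ * Real.cos θ)
  | 3, 1, 3 => r⁻¹
  | 3, 3, 1 => r⁻¹
  | 3, 2, 3 => Real.cos θ / Real.sin θ
  | 3, 3, 2 => Real.cos θ / Real.sin θ
  | _, _, _ => 0

theorem christoffel_staticMetric {nu lam : ℝ → ℝ} {x : Fin 4 → ℝ} (hx : x ∈ chart)
    (hn : DifferentiableAt ℝ nu (x 1)) (hl : DifferentiableAt ℝ lam (x 1)) (σ μ ν : Fin 4) :
    christoffel (staticMetric nu lam) x σ μ ν = staticChristoffel nu lam (x 1) (x 2) σ μ ν := by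
  have h1 : x 1 ≠ 0 := hx.1.ne'
  have hs : Real.sin (x 2) ≠ 0 := (Real.sin_pos_of_pos_of_lt_pi hx.2.1 hx.2.2).ne'
  have e1 := Real.exp_ne_zero (2 * nu (x 1))
  have e2 := Real.exp_ne_zero (2 * lam (x 1))
  unfold christoffel
  simp only [staticMetric_inv nu lam hx, partialDeriv_staticMetric hn hl]
  simp only [Matrix.diagonal_apply, ite_mul, zero_mul, Finset.sum_ite_eq, Finset.mem_univ, if_true]
  fin_cases σ <;> fin_cases μ <;> fin_cases ν <;>
    simp [staticChristoffel, Real.exp_sub, Real.exp_neg] <;> field_simp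

theorem isOpen_chart : IsOpen chart :=
  (isOpen_lt continuous_const (continuous_apply 1)).inter
    ((isOpen_lt continuous_const (continuous_apply 2)).inter
      (isOpen_lt (continuous_apply 2) continuous_const))

theorem partialDeriv_congr_chart {f g : (Fin 4 → ℝ) → ℝ} (h : ∀ x ∈ chart, f x = g x)
    {x : Fin 4 → ℝ} (hx : x ∈ chart) (i : Fin 4) : partialDeriv i f x = partialDeriv i g x := by
  apply Filter.EventuallyEq.deriv_eq
  have hc : ContinuousAt (fun s => Function.update x i s) (x i) :=
    (continuous_const.update i continuous_id).continuousAt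
  have : ∀ᶠ s in 𝓝 (x i), Function.update x i s ∈ chart := by
    apply hc.eventually
    simpa only [Function.update_eq_self] using isOpen_chart.eventually_mem hx
  filter_upwards [this] with s hs using h _ hs

/-- The `r`-derivatives of the Christoffel symbols of the static metric. -/
def staticChristoffelRadial (nu lam : ℝ → ℝ) (r θ : ℝ) : Fin 4 → Fin 4 → Fin 4 → ℝ
  | 0, 0, 1 => deriv (deriv nu) r
  | 0, 1, 0 => deriv (deriv nu) r
  | 1, 0, 0 => (deriv (deriv nu) r + 2 * deriv nu r * (deriv nu r - deriv lam r)) *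
      Real.exp (2 * nu r - 2 * lam r)
  | 1, 1, 1 => deriv (deriv lam) r
  | 1, 2, 2 => -((1 - 2 * r * deriv lam r) * Real.exp (-(2 * lam r)))
  | 1, 3, 3 => -((1 - 2 * r * deriv lam r) * Real.exp (-(2 * lam r)) * Real.sin θ ^ 2)
  | 2, 1, 2 => -(r ^ 2)⁻¹
  | 2, 2, 1 => -(r ^ 2)⁻¹
  | 3, 1, 3 => -(r ^ 2)⁻¹
  | 3, 3, 1 => -(r ^ 2)⁻¹
  | _, _, _ => 0

/-- The `θ`-derivatives of the Christoffel symbols of the static metric. -/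
def staticChristoffelPolar (lam : ℝ → ℝ) (r θ : ℝ) : Fin 4 → Fin 4 → Fin 4 → ℝ
  | 1, 3, 3 => -(r * Real.exp (-(2 * lam r)) * (2 * Real.sin θ * Real.cos θ))
  | 2, 3, 3 => -(Real.cos θ ^ 2 - Real.sin θ ^ 2)
  | 3, 2, 3 => -(Real.sin θ ^ 2)⁻¹
  | 3, 3, 2 => -(Real.sin θ ^ 2)⁻¹
  | _, _, _ => 0

/-- Differentiability of `deriv lam` is not needed: `λ''` occurs only in the `1, 1, 1` entry, where
it is `deriv (deriv lam)` by definition, and it cancels in the Ricci tensor. -/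
theorem deriv_staticChristoffel_radial {nu lam : ℝ → ℝ} {r : ℝ} (θ : ℝ)
    (hn : DifferentiableAt ℝ nu r) (hl : DifferentiableAt ℝ lam r)
    (hn' : DifferentiableAt ℝ (deriv nu) r) (σ μ ν : Fin 4) :
    deriv (fun s => staticChristoffel nu lam s θ σ μ ν) r =
      staticChristoffelRadial nu lam r θ σ μ ν := by
  have e1 : deriv (fun s => deriv nu s * Real.exp (2 * nu s - 2 * lam s)) r =
      (deriv (deriv nu) r + 2 * deriv nu r * (deriv nu r - deriv lam r)) *
          Real.exp (2 * nu r - 2 * lam r) := by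
    have := (hn'.hasDerivAt.fun_mul
      (((hn.hasDerivAt.const_mul 2).fun_sub (hl.hasDerivAt.const_mul 2)).exp)).deriv
    rw [this]; ring
  have e2 : deriv (fun s => s * Real.exp (-(2 * lam s))) r =
      (1 - 2 * r * deriv lam r) * Real.exp (-(2 * lam r)) := by
    have := ((hasDerivAt_id' r).fun_mul ((hl.hasDerivAt.const_mul 2).fun_neg.exp)).deriv
    rw [this]; ring
  clear hn hl hn'
  fin_cases σ <;> fin_cases μ <;> fin_cases ν <;>
    simp [staticChristoffel, staticChristoffelRadial, e1, e2]

theorem deriv_staticChristoffel_polar (nu lam : ℝ → ℝ) (r : ℝ) {θ : ℝ} (hs : Real.sin θ ≠ 0)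
    (σ μ ν : Fin 4) :
    deriv (fun s => staticChristoffel nu lam r s σ μ ν) θ =
      staticChristoffelPolar lam r θ σ μ ν := by
  have e3 : deriv (fun s => Real.sin s ^ 2) θ = 2 * Real.sin θ * Real.cos θ := by
    have := ((Real.hasDerivAt_sin θ).fun_pow 2).deriv
    rw [this]; norm_num
  have e4 : deriv (fun s => Real.sin s * Real.cos s) θ =
      Real.cos θ ^ 2 - Real.sin θ ^ 2 := by
    have := ((Real.hasDerivAt_sin θ).fun_mul (Real.hasDerivAt_cos θ)).deriv
    rw [this]; ring
  have e5 : deriv (fun s => Real.cos s / Real.sin s) θ = -(Real.sin θ ^ 2)⁻¹ := by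
    have := ((Real.hasDerivAt_cos θ).fun_div (Real.hasDerivAt_sin θ) hs).deriv
    rw [this, div_eq_iff (pow_ne_zero 2 hs)]
    field_simp
    nlinarith [Real.sin_sq_add_cos_sq θ]
  fin_cases σ <;> fin_cases μ <;> fin_cases ν <;>
    simp only [staticChristoffel, staticChristoffelPolar, Fin.zero_eta, Fin.mk_one,
      Fin.reduceFinMk, deriv_const'] <;>
    first | done | simp [e3, e4, e5]

theorem partialDeriv_radial_polar (F : ℝ → ℝ → ℝ) (i : Fin 4) (x : Fin 4 → ℝ) :
    partialDeriv i (fun y => F (y 1) (y 2)) x =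
      ![0, deriv (fun r => F r (x 2)) (x 1), deriv (fun θ => F (x 1) θ) (x 2), 0] i := by
  fin_cases i <;> simp [partialDeriv]

set_option maxHeartbeats 4000000 in
theorem ricci_staticMetric {nu lam : ℝ → ℝ} (hn : ContDiffOn ℝ 2 nu (Ioi 0))
    (hl : ContDiffOn ℝ 2 lam (Ioi 0)) {x : Fin 4 → ℝ} (hx : x ∈ chart) (μ ν : Fin 4) :
    ricci (staticMetric nu lam) x μ ν = Matrix.diagonal
      ![Real.exp (2 * nu (x 1) - 2 * lam (x 1)) * (deriv (deriv nu) (x 1) + deriv nu (x 1) ^ 2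
          - deriv nu (x 1) * deriv lam (x 1) + 2 * deriv nu (x 1) / x 1),
        -(deriv (deriv nu) (x 1)) - deriv nu (x 1) ^ 2 + deriv nu (x 1) * deriv lam (x 1)
          + 2 * deriv lam (x 1) / x 1,
        1 - Real.exp (-(2 * lam (x 1))) * (1 + x 1 * (deriv nu (x 1) - deriv lam (x 1))),
        (1 - Real.exp (-(2 * lam (x 1))) * (1 + x 1 * (deriv nu (x 1) - deriv lam (x 1)))) *
          Real.sin (x 2) ^ 2] μ ν := by
  have hdn : ∀ y ∈ chart, DifferentiableAt ℝ nu (y 1) := fun y hy =>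
    (hn.differentiableOn (by norm_num)).differentiableAt (Ioi_mem_nhds hy.1)
  have hdl : ∀ y ∈ chart, DifferentiableAt ℝ lam (y 1) := fun y hy =>
    (hl.differentiableOn (by norm_num)).differentiableAt (Ioi_mem_nhds hy.1)
  have hn' : DifferentiableAt ℝ (deriv nu) (x 1) := by
    have h2 : ContDiffOn ℝ 1 (deriv nu) (Ioi 0) := hn.deriv_of_isOpen isOpen_Ioi (by norm_num)
    exact (h2.differentiableOn (by norm_num)).differentiableAt (Ioi_mem_nhds hx.1)
  have hs : Real.sin (x 2) ≠ 0 := (Real.sin_pos_of_pos_of_lt_pi hx.2.1 hx.2.2).ne'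
  have hP : ∀ i σ μ ν, partialDeriv i (fun y => christoffel (staticMetric nu lam) y σ μ ν) x =
      ![0, staticChristoffelRadial nu lam (x 1) (x 2) σ μ ν,
        staticChristoffelPolar lam (x 1) (x 2) σ μ ν, 0] i := fun i σ μ ν => by
    rw [← deriv_staticChristoffel_radial (x 2) (hdn x hx) (hdl x hx) hn',
      ← deriv_staticChristoffel_polar nu lam (x 1) hs,
      ← partialDeriv_radial_polar (fun r θ => staticChristoffel nu lam r θ σ μ ν)]
    exact partialDeriv_congr_chart
      (fun y hy => christoffel_staticMetric hy (hdn y hy) (hdl y hy) σ μ ν) hx i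
  have h1 : x 1 ≠ 0 := hx.1.ne'
  have hc := Real.cos_sq' (x 2)
  unfold ricci
  simp only [hP, christoffel_staticMetric hx (hdn x hx) (hdl x hx), Fin.sum_univ_four]
  clear hP hn hl hdn hdl hn' hx
  generalize x 1 = r at *
  generalize x 2 = θ at *
  fin_cases μ <;> fin_cases ν <;>
    simp [staticChristoffel, staticChristoffelRadial, staticChristoffelPolar]
  · field_simp
    ring
  · field_simp
    ring
  · ring
  · field_simp
    rw [hc]
    ring
  · field_simp
    rw [hc]
    ring

theorem scalarCurvature_staticMetric {nu lam : ℝ → ℝ} (hn : ContDiffOn ℝ 2 nu (Ioi 0))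
    (hl : ContDiffOn ℝ 2 lam (Ioi 0)) {x : Fin 4 → ℝ} (hx : x ∈ chart) :
    scalarCurvature (staticMetric nu lam) x =
      -(2 * Real.exp (-(2 * lam (x 1))) * (deriv (deriv nu) (x 1) + deriv nu (x 1) ^ 2
          - deriv nu (x 1) * deriv lam (x 1) + 2 * (deriv nu (x 1) - deriv lam (x 1)) / x 1))
        + 2 * (1 - Real.exp (-(2 * lam (x 1)))) / x 1 ^ 2 := by
  have h1 : x 1 ≠ 0 := hx.1.ne'
  have hs : Real.sin (x 2) ≠ 0 := (Real.sin_pos_of_pos_of_lt_pi hx.2.1 hx.2.2).ne'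
  unfold scalarCurvature
  simp only [staticMetric_inv nu lam hx, ricci_staticMetric hn hl hx, Matrix.diagonal_apply,
    ite_mul, zero_mul, mul_ite, mul_zero, Finset.sum_ite_eq, Finset.mem_univ, if_true,
    Fin.sum_univ_four]
  simp [Real.exp_sub, Real.exp_neg]
  have e1 := Real.exp_ne_zero (2 * nu (x 1))
  have e2 := Real.exp_ne_zero (2 * lam (x 1))
  field_simp
  ring

/-! ### Reduction to radial equations -/

/-- For a perfect fluid with diagonal Einstein tensor the velocity is along the static direction,
unless the density vanishes. -/
theorem fluid_stress_of_diagonal {q : ℝ} {d w : Fin 4 → ℝ} (h1 : 0 < d 1) (h2 : 0 < d 2)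
    (h3 : 0 < d 3) (hw : ∑ i, d i * w i * w i = -1)
    (hoff : ∀ i j, i ≠ j → q * (d i * w i) * (d j * w j) = 0) :
    q * (d 0 * w 0) * (d 0 * w 0) = -(q * d 0) ∧ q * (d 1 * w 1) * (d 1 * w 1) = 0 ∧
      q * (d 2 * w 2) * (d 2 * w 2) = 0 := by
  by_cases hq : q = 0
  · simp [hq]
  rw [Fin.sum_univ_four] at hw
  -- Otherwise `w` would have nonnegative norm, contradicting that it is timelike. The mixed
  -- components `0 j` then annihilate the spatial part.
  have h0 : d 0 * w 0 ≠ 0 := by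
    intro h
    rw [h] at hw
    nlinarith [mul_nonneg h1.le (sq_nonneg (w 1)), mul_nonneg h2.le (sq_nonneg (w 2)),
      mul_nonneg h3.le (sq_nonneg (w 3))]
  have hz : ∀ j, 0 ≠ j → d j * w j = 0 := fun j hj => by
    have := hoff 0 j hj
    simpa [hq, h0] using this
  have z1 := hz 1 (by decide)
  have z2 := hz 2 (by decide)
  have z3 := hz 3 (by decide)
  rw [z1, z2, z3] at hw
  refine ⟨?_, by simp [z1], by simp [z2]⟩
  linear_combination q * d 0 * hw

/-- These are the `tt`, `rr` and `θθ` components, once the fluid terms are known to be those of a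
fluid at rest. -/
theorem IsStaticSolution.field_equations {k ρ₀ : ℝ} {nu lam ρ : ℝ → ℝ}
    {u : (Fin 4 → ℝ) → Fin 4 → ℝ} (hsol : IsStaticSolution k ρ₀ nu lam ρ u) {r : ℝ}
    (hr : 0 < r) :
    8 * Real.pi * r ^ 2 * ρ r = 1 - Real.exp (-(2 * lam r)) * (1 - 2 * r * deriv lam r) ∧
    8 * Real.pi * r ^ 2 * (k ^ 2 * ρ r) =
      Real.exp (-(2 * lam r)) * (1 + 2 * r * deriv nu r) - 1 ∧
    8 * Real.pi * (k ^ 2 * ρ r) =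
      Real.exp (-(2 * lam r)) * (deriv (deriv nu) r + deriv nu r ^ 2 - deriv nu r * deriv lam r
        + (deriv nu r - deriv lam r) / r) := by
  -- On the equator `sin θ = 1`, so the angular factor disappears; one point for each `r` suffices.
  let x : Fin 4 → ℝ := ![0, r, Real.pi / 2, 0]
  have hx : x ∈ chart := ⟨hr, by simp [x, Real.pi_pos], by simp [x, Real.pi_pos]⟩
  have hx1 : x 1 = r := rfl
  have hx2 : Real.sin (x 2) = 1 := Real.sin_pi_div_two
  let d : Fin 4 → ℝ := ![-Real.exp (2 * nu r), Real.exp (2 * lam r), r ^ 2, r ^ 2]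
  have hg : staticMetric nu lam x = Matrix.diagonal d := by
    simp only [staticMetric, hx1, hx2, d]
    norm_num
  have hlow : ∀ i, lower (staticMetric nu lam) u x i = d i * u x i := fun i => by
    simp [lower, hg, Matrix.diagonal_apply]
  have hE : ∀ μ ν, ricci (staticMetric nu lam) x μ ν
      - 1 / 2 * scalarCurvature (staticMetric nu lam) x * Matrix.diagonal d μ ν =
      8 * Real.pi * ((ρ r + k ^ 2 * ρ r) * (d μ * u x μ) * (d ν * u x ν)
        + k ^ 2 * ρ r * Matrix.diagonal d μ ν) := fun μ ν => by
    have := hsol.einstein x hx μ ν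
    simpa only [einsteinTensor, perfectFluid, hlow, hg, hx1] using this
  have hR := fun μ ν => ricci_staticMetric hsol.contDiffOn_nu hsol.contDiffOn_lam hx μ ν
  have hunit := hsol.unit_timelike x hx
  simp only [hlow] at hunit
  have hpi := Real.pi_pos
  obtain ⟨f0, f1, f2⟩ := fluid_stress_of_diagonal (q := ρ r + k ^ 2 * ρ r) (d := d) (w := u x)
    (Real.exp_pos _) (pow_pos hr 2) (pow_pos hr 2) hunit (fun i j hij => by
      have := hE i j
      rw [hR, Matrix.diagonal_apply_ne _ hij, Matrix.diagonal_apply_ne _ hij] at this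
      have h8 : 8 * Real.pi ≠ 0 := by positivity
      simp only [mul_zero, sub_zero, add_zero] at this
      exact (mul_eq_zero.mp this.symm).resolve_left h8)
  have g0 := hE 0 0
  have g1 := hE 1 1
  have g2 := hE 2 2
  rw [f0] at g0
  rw [f1] at g1
  rw [f2] at g2
  rw [hR, scalarCurvature_staticMetric hsol.contDiffOn_nu hsol.contDiffOn_lam hx] at g0 g1 g2
  simp only [Matrix.diagonal_apply_eq, hx1, hx2, d, Matrix.cons_val_zero, Matrix.cons_val_one,
    Matrix.cons_val] at g0 g1 g2
  have e1 := Real.exp_ne_zero (2 * nu r)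
  have e2 := Real.exp_ne_zero (2 * lam r)
  have hr0 := hr.ne'
  rw [Real.exp_sub] at g0
  rw [Real.exp_neg] at *
  refine ⟨?_, ?_, ?_⟩
  · field_simp at g0 ⊢
    linear_combination -g0
  · field_simp at g1 ⊢
    linear_combination -g1
  · field_simp at g2 ⊢
    apply mul_left_cancel₀ hr0
    linear_combination -g2

/-! ### Integrals from the center -/

section Center

variable {f : ℝ → ℝ} {L : ℝ}

/-- Nothing is known about `f` on `(-∞, 0]`. Filling in the limit `L` there gives a continuous
function, to which the fundamental theorem of calculus applies at `0` as well; integrals over `(0,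
r]` are unaffected. -/
theorem exists_continuous_extension (hf : ContinuousOn f (Ioi 0))
    (h0 : Tendsto f (𝓝[>] 0) (𝓝 L)) : ∃ g : ℝ → ℝ, Continuous g ∧ ∀ s, 0 < s → g s = f s := by
  refine ⟨fun s => if s ≤ 0 then L else f s, ?_, fun s hs => if_neg hs.not_ge⟩
  rw [continuous_iff_continuousAt]
  intro s
  rcases lt_trichotomy s 0 with hs | rfl | hs
  · refine (continuousAt_const (y := L)).congr ?_
    filter_upwards [Iio_mem_nhds hs] with z hz using (if_pos (le_of_lt hz)).symm
  · rw [continuousAt_iff_continuous_left'_right']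
    constructor
    · refine (tendsto_const_nhds (x := L)).congr' ?_ |>.trans_eq ?_
      · filter_upwards [self_mem_nhdsWithin] with z hz using (if_pos (le_of_lt hz)).symm
      · simp
    · have : Tendsto (fun s => if s ≤ 0 then L else f s) (𝓝[>] 0) (𝓝 L) := h0.congr' <| by
        filter_upwards [self_mem_nhdsWithin] with z hz using (if_neg (not_le.mpr hz)).symm
      simpa [ContinuousWithinAt] using this
  · refine ((hf s hs).continuousAt (Ioi_mem_nhds hs)).congr ?_
    filter_upwards [Ioi_mem_nhds hs] with z hz using (if_neg (not_le.mpr hz)).symm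

theorem integral_from_center (hf : ContinuousOn f (Ioi 0)) (h0 : Tendsto f (𝓝[>] 0) (𝓝 L)) :
    (∀ r, 0 < r → HasDerivAt (fun r => ∫ s in (0 : ℝ)..r, f s) (f r) r) ∧
      Tendsto (fun r => ∫ s in (0 : ℝ)..r, f s) (𝓝[>] 0) (𝓝 0) := by
  obtain ⟨g, hg, hgf⟩ := exists_continuous_extension hf h0
  have hint : ∀ r, 0 < r → ∫ s in (0 : ℝ)..r, g s = ∫ s in (0 : ℝ)..r, f s := fun r hr => by
    apply intervalIntegral.integral_congr_ae
    filter_upwards with s hs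
    rw [uIoc_of_le hr.le] at hs
    exact hgf s hs.1
  have hd : ∀ r, HasDerivAt (fun r => ∫ s in (0 : ℝ)..r, g s) (g r) r := fun r =>
    intervalIntegral.integral_hasDerivAt_right (hg.intervalIntegrable _ _)
      hg.stronglyMeasurable.stronglyMeasurableAtFilter hg.continuousAt
  constructor
  · intro r hr
    rw [← hgf r hr]
    refine (hd r).congr_of_eventuallyEq ?_
    filter_upwards [Ioi_mem_nhds hr] with z hz using (hint z hz).symm
  · have h1 : Tendsto (fun r => ∫ s in (0 : ℝ)..r, g s) (𝓝[>] 0) (𝓝 (∫ s in (0 : ℝ)..0, g s)) :=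
      (hd 0).continuousAt.tendsto.mono_left nhdsWithin_le_nhds
    rw [intervalIntegral.integral_same] at h1
    refine h1.congr' ?_
    filter_upwards [self_mem_nhdsWithin] with z hz using hint z hz

theorem exists_const_of_hasDerivAt_zero (hf : ∀ r, 0 < r → HasDerivAt f 0 r) :
    ∃ C, ∀ r, 0 < r → f r = C := by
  refine ⟨f 1, fun r hr => ?_⟩
  exact isOpen_Ioi.is_const_of_deriv_eq_zero isPreconnected_Ioi
    (fun s hs => (hf s hs).differentiableAt.differentiableWithinAt)
    (fun s hs => (hf s hs).deriv) hr (mem_Ioi.mpr one_pos)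

end Center

/-! ### Euler equation, density law and mass function -/

namespace IsStaticSolution

variable {k ρ₀ : ℝ} {nu lam ρ : ℝ → ℝ} {u : (Fin 4 → ℝ) → Fin 4 → ℝ}

theorem hasDerivAt_nu (hsol : IsStaticSolution k ρ₀ nu lam ρ u) {r : ℝ} (hr : 0 < r) :
    HasDerivAt nu (deriv nu r) r :=
  ((hsol.contDiffOn_nu.differentiableOn (by norm_num)).differentiableAt
    (Ioi_mem_nhds hr)).hasDerivAt

theorem hasDerivAt_deriv_nu (hsol : IsStaticSolution k ρ₀ nu lam ρ u) {r : ℝ} (hr : 0 < r) :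
    HasDerivAt (deriv nu) (deriv (deriv nu) r) r :=
  (((hsol.contDiffOn_nu.deriv_of_isOpen (m := 1) isOpen_Ioi (by norm_num)).differentiableOn
    (by norm_num)).differentiableAt (Ioi_mem_nhds hr)).hasDerivAt

theorem hasDerivAt_lam (hsol : IsStaticSolution k ρ₀ nu lam ρ u) {r : ℝ} (hr : 0 < r) :
    HasDerivAt lam (deriv lam r) r :=
  ((hsol.contDiffOn_lam.differentiableOn (by norm_num)).differentiableAt
    (Ioi_mem_nhds hr)).hasDerivAt

theorem hasDerivAt_exp_lam (hsol : IsStaticSolution k ρ₀ nu lam ρ u) {r : ℝ} (hr : 0 < r) :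
    HasDerivAt (fun r => Real.exp (-(2 * lam r)))
      (-(2 * deriv lam r * Real.exp (-(2 * lam r)))) r :=
  (((hsol.hasDerivAt_lam hr).const_mul 2).fun_neg.exp).congr_deriv (by ring)

/-- The Euler equation `p' = -(ρ + p) ν'`. -/
theorem hasDerivAt_density (hsol : IsStaticSolution k ρ₀ nu lam ρ u) (hk : 0 < k) {r : ℝ}
    (hr : 0 < r) : HasDerivAt ρ (-((1 + k ^ 2) / k ^ 2 * ρ r * deriv nu r)) r := by
  have hpi := Real.pi_pos
  have hd := (((hsol.hasDerivAt_exp_lam hr).fun_mul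
    ((((hasDerivAt_id' r).const_mul 2).fun_mul (hsol.hasDerivAt_deriv_nu hr)).const_add 1)).sub_const
      1).fun_div (((hasDerivAt_id' r).fun_pow 2).const_mul (8 * Real.pi * k ^ 2)) (by positivity)
  -- No regularity of `ρ` is assumed; the `rr` equation expresses it through `ν'` and `λ`, which are
  -- differentiable. The resulting `ν''` is then eliminated by the `θθ` equation.
  have heq : ρ =ᶠ[𝓝 r] fun r => (Real.exp (-(2 * lam r)) * (1 + 2 * r * deriv nu r) - 1) /
      (8 * Real.pi * k ^ 2 * r ^ 2) := by
    filter_upwards [Ioi_mem_nhds hr] with s hs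
    have hs' : 0 < s := hs
    rw [eq_div_iff (by positivity), ← (hsol.field_equations hs).2.1]
    ring
  refine (hd.congr_of_eventuallyEq heq).congr_deriv ?_
  obtain ⟨hA, hB, hC⟩ := hsol.field_equations hr
  rw [← hB]
  generalize Real.exp (-(2 * lam r)) = E at *
  have hC' : 8 * Real.pi * r * (k ^ 2 * ρ r) = E * (r * (deriv (deriv nu) r + deriv nu r ^ 2
      - deriv nu r * deriv lam r) + (deriv nu r - deriv lam r)) := by
    field_simp at hC
    linear_combination hC
  have hσ : (1 + k ^ 2) / k ^ 2 * ρ r * deriv nu r * (8 * Real.pi * k ^ 2 * r ^ 2) =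
      8 * Real.pi * (1 + k ^ 2) * r ^ 2 * ρ r * deriv nu r := by
    field_simp
  rw [div_eq_iff (by positivity)]
  linear_combination (8 * Real.pi * k ^ 2 * r ^ 2) * (-2 * hC' + deriv nu r * (hA + hB) + hσ)

theorem exists_density_eq (hsol : IsStaticSolution k ρ₀ nu lam ρ u) (hk : 0 < k)
    (hρ₀ : 0 < ρ₀) : ∃ ν₀, Tendsto nu (𝓝[>] 0) (𝓝 ν₀) ∧
      ∀ r, 0 < r → ρ r = ρ₀ * Real.exp (-((1 + k ^ 2) / k ^ 2 * (nu r - ν₀))) := by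
  set σ := (1 + k ^ 2) / k ^ 2 with hσ
  have hσ0 : 0 < σ := by positivity
  obtain ⟨C, hC⟩ := exists_const_of_hasDerivAt_zero
    (f := fun r => ρ r * Real.exp (σ * nu r)) fun r hr => by
      refine ((hsol.hasDerivAt_density hk hr).fun_mul
        ((hsol.hasDerivAt_nu hr).const_mul σ).exp).congr_deriv ?_
      rw [← hσ]
      ring
  have hρ : ∀ r, 0 < r → ρ r = C * Real.exp (-(σ * nu r)) := fun r hr => by
    rw [← hC r hr, mul_assoc, ← Real.exp_add, add_neg_cancel, Real.exp_zero, mul_one]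
  -- The density is positive near the center, which fixes the sign of the constant. Taking
  -- logarithms then expresses `ν` through `ρ`, so the limit of `ρ` gives one for `ν`.
  have hC0 : 0 < C := by
    obtain ⟨r, h1, h2⟩ := ((hsol.central_density.eventually_const_lt hρ₀).and
      self_mem_nhdsWithin).exists
    rw [hρ r h2] at h1
    exact pos_of_mul_pos_left h1 (Real.exp_pos _).le
  have hnu : ∀ r, 0 < r → nu r = (Real.log C - Real.log (ρ r)) / σ := fun r hr => by
    rw [hρ r hr, Real.log_mul hC0.ne' (Real.exp_pos _).ne', Real.log_exp]
    field_simp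
    ring
  refine ⟨(Real.log C - Real.log ρ₀) / σ, ?_, fun r hr => ?_⟩
  · refine (((hsol.central_density.log hρ₀.ne').const_sub _).div_const _).congr' ?_
    filter_upwards [self_mem_nhdsWithin] with r hr using (hnu r hr).symm
  · have : -(σ * (nu r - (Real.log C - Real.log ρ₀) / σ)) =
        Real.log C - Real.log ρ₀ + -(σ * nu r) := by field_simp; ring
    rw [hρ r hr, this, Real.exp_add, Real.exp_sub, Real.exp_log hC0, Real.exp_log hρ₀]
    field_simp

/-- By the `tt` equation `2m - r(1 - e^{-2λ})` has zero derivative, and the regular center makes its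
limit at `0` vanish. -/
theorem exp_lam_eq (hsol : IsStaticSolution k ρ₀ nu lam ρ u) (hk : 0 < k) {r : ℝ} (hr : 0 < r) :
    Real.exp (-(2 * lam r)) = 1 - 2 * massFunction ρ r / r := by
  have hcont : ContinuousOn (fun s => 4 * Real.pi * s ^ 2 * ρ s) (Ioi 0) := fun s hs =>
    ((continuous_const.mul (continuous_pow 2)).continuousAt.mul
      (hsol.hasDerivAt_density hk hs).continuousAt).continuousWithinAt
  have h0 : Tendsto (fun s => 4 * Real.pi * s ^ 2 * ρ s) (𝓝[>] 0) (𝓝 (4 * Real.pi * 0 ^ 2 * ρ₀)) :=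
    (((continuous_const.mul (continuous_pow 2)).tendsto 0).mono_left nhdsWithin_le_nhds).mul
      hsol.central_density
  obtain ⟨hd, hz⟩ := integral_from_center hcont h0
  obtain ⟨C, hC⟩ := exists_const_of_hasDerivAt_zero
    (f := fun r => 2 * massFunction ρ r - r * (1 - Real.exp (-(2 * lam r)))) fun r hr => by
      refine (((hd r hr).const_mul 2).fun_sub ((hasDerivAt_id' r).fun_mul
        ((hsol.hasDerivAt_exp_lam hr).const_sub 1))).congr_deriv ?_
      linear_combination (hsol.field_equations hr).1
  have hlim : Tendsto (fun r => 2 * massFunction ρ r - r * (1 - Real.exp (-(2 * lam r))))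
      (𝓝[>] 0) (𝓝 (2 * 0 - 0 * (1 - Real.exp (-(2 * 0))))) :=
    (hz.const_mul 2).sub ((tendsto_id.mono_left nhdsWithin_le_nhds).mul
      (((hsol.regular_center.const_mul 2).neg.rexp).const_sub 1))
  have hC0 : C = 0 := by
    have h1 : Tendsto (fun r => 2 * massFunction ρ r - r * (1 - Real.exp (-(2 * lam r))))
        (𝓝[>] 0) (𝓝 C) := tendsto_const_nhds.congr' <| by
      filter_upwards [self_mem_nhdsWithin] with s hs using (hC s hs).symm
    simpa using tendsto_nhds_unique h1 hlim
  have := hC r hr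
  rw [hC0] at this
  field_simp
  linear_combination this

theorem density_pos (hsol : IsStaticSolution k ρ₀ nu lam ρ u) (hk : 0 < k) (hρ₀ : 0 < ρ₀)
    {r : ℝ} (hr : 0 < r) : 0 < ρ r := by
  obtain ⟨ν₀, -, h⟩ := hsol.exists_density_eq hk hρ₀
  rw [h r hr]
  positivity

theorem massFunction_nonneg (hsol : IsStaticSolution k ρ₀ nu lam ρ u) (hk : 0 < k)
    (hρ₀ : 0 < ρ₀) {r : ℝ} (hr : 0 < r) : 0 ≤ massFunction ρ r := by
  apply intervalIntegral.integral_nonneg hr.le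
  rintro s ⟨hs, -⟩
  rcases hs.eq_or_lt with rfl | hs
  · simp
  · have := hsol.density_pos hk hρ₀ hs
    positivity

end IsStaticSolution

/-! ### Convergence criteria -/

/-- If `W` is bounded below with `W' ≤ -c φ²` and `φ` has bounded derivative, then `φ → 0`. -/
theorem tendsto_zero_of_dissipation {φ φ' W W' : ℝ → ℝ} {c L B : ℝ} (hc : 0 < c)
    (hφ : ∀ s, HasDerivAt φ (φ' s) s) (hL : ∀ s, 0 ≤ s → |φ' s| ≤ L)
    (hW : ∀ s, HasDerivAt W (W' s) s) (hle : ∀ s, 0 ≤ s → W' s ≤ -(c * φ s ^ 2))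
    (hB : ∀ s, 0 ≤ s → B ≤ W s) : Tendsto φ atTop (𝓝 0) := by
  have hanti : AntitoneOn W (Ici 0) := by
    apply antitoneOn_of_deriv_nonpos (convex_Ici 0)
      (fun s _ => (hW s).continuousAt.continuousWithinAt)
      (fun s _ => (hW s).differentiableAt.differentiableWithinAt)
    intro s hs
    rw [interior_Ici] at hs
    rw [(hW s).deriv]
    have := hle s (le_of_lt hs)
    nlinarith [mul_nonneg hc.le (sq_nonneg (φ s))]
  obtain ⟨l, hl⟩ : ∃ l, Tendsto W atTop (𝓝 l) := by
    have hmono : Antitone fun s => W (max s 0) := fun a b hab =>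
      hanti (le_max_right a 0) (le_max_right b 0) (max_le_max_right 0 hab)
    have hbdd : BddBelow (range fun s => W (max s 0)) :=
      ⟨B, by rintro _ ⟨s, rfl⟩; exact hB _ (le_max_right s 0)⟩
    refine ⟨_, (tendsto_atTop_ciInf hmono hbdd).congr' ?_⟩
    filter_upwards [eventually_ge_atTop 0] with s hs
    rw [max_eq_left hs]
  have hL0 : 0 ≤ L := (abs_nonneg _).trans (hL 0 le_rfl)
  rw [Metric.tendsto_atTop]
  intro ε hε
  -- Chosen so that `φ` varies by less than `ε/2` over a time `δ`; `L + 1` avoids division by zero.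
  -- The drop of `W` over `[s, s + δ]` tends to zero, so some `ξ` there has `|φ ξ| < ε/2`.
  set δ := ε / (2 * (L + 1)) with hδ
  have hδ0 : 0 < δ := by positivity
  have hdiff : Tendsto (fun s => W s - W (s + δ)) atTop (𝓝 0) := by
    have := hl.sub (hl.comp (tendsto_atTop_add_const_right atTop δ tendsto_id))
    simpa using this
  have hev : ∀ᶠ s in atTop, W s - W (s + δ) < c * (ε / 2) ^ 2 * δ :=
    hdiff.eventually_lt_const (by positivity)
  obtain ⟨S, hS⟩ := eventually_atTop.mp (hev.and (eventually_ge_atTop 0))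
  refine ⟨S, fun s hs => ?_⟩
  obtain ⟨hs1, hs0⟩ := hS s hs
  obtain ⟨ξ, hξ, hξe⟩ := exists_hasDerivAt_eq_slope W W' (show s < s + δ by linarith)
    (fun z _ => (hW z).continuousAt.continuousWithinAt) (fun z _ => hW z)
  have hξ0 : 0 ≤ ξ := hs0.trans hξ.1.le
  have h1 : φ ξ ^ 2 < (ε / 2) ^ 2 := by
    have h2 := hle ξ hξ0
    rw [hξe, div_le_iff₀ (by linarith)] at h2
    have h3 : c * φ ξ ^ 2 * δ < c * (ε / 2) ^ 2 * δ := by nlinarith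
    exact lt_of_mul_lt_mul_left (lt_of_mul_lt_mul_right h3 hδ0.le) hc.le
  have h4 : |φ ξ| < ε / 2 := abs_lt_of_sq_lt_sq h1 (by positivity)
  obtain ⟨η, hη, hηe⟩ := exists_hasDerivAt_eq_slope φ φ' hξ.1
    (fun z _ => (hφ z).continuousAt.continuousWithinAt) (fun z _ => hφ z)
  have h5 : |φ ξ - φ s| < ε / 2 := by
    have h6 := hL η (hs0.trans hη.1.le)
    have h7 : 0 < ξ - s := sub_pos.mpr hξ.1
    rw [hηe, abs_div, abs_of_pos h7, div_le_iff₀ h7] at h6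
    have h8 : ξ - s < δ := by linarith [hξ.2]
    have h9 : (L + 1) * δ = ε / 2 := by rw [hδ]; field_simp
    nlinarith
  rw [Real.dist_eq, sub_zero]
  rw [abs_lt] at *
  constructor <;> linarith [h4.1, h4.2, h5.1, h5.2]

theorem eventually_le_of_linear_ode {z e : ℝ → ℝ} {B ε : ℝ} (hB : 0 < B) (hε : 0 < ε)
    (hz : ∀ s, HasDerivAt z (-(B * z s) + e s) s) (he : Tendsto e atTop (𝓝 0)) :
    ∀ᶠ s in atTop, z s < 2 * ε := by
  obtain ⟨S, hS⟩ := eventually_atTop.mp (he.eventually_lt_const (show 0 < B * ε by positivity))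
  -- Integrating factor: once `e < Bε`, the function `(z - ε) e^{Bs}` decreases, so `z - ε` is
  -- bounded above by a multiple of `e^{-Bs}`.
  have hg : ∀ s, HasDerivAt (fun s => (z s - ε) * Real.exp (B * s))
      ((e s - B * ε) * Real.exp (B * s)) s := fun s => by
    have := ((hz s).sub_const ε).fun_mul (((hasDerivAt_id' s).const_mul B).exp)
    exact this.congr_deriv (by ring)
  have hanti : AntitoneOn (fun s => (z s - ε) * Real.exp (B * s)) (Ici S) := by
    apply antitoneOn_of_deriv_nonpos (convex_Ici S)
      (fun s _ => (hg s).continuousAt.continuousWithinAt)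
      (fun s _ => (hg s).differentiableAt.differentiableWithinAt)
    intro s hs
    rw [interior_Ici] at hs
    rw [(hg s).deriv]
    exact mul_nonpos_of_nonpos_of_nonneg (by linarith [hS s (le_of_lt hs)]) (Real.exp_pos _).le
  have hlim : Tendsto (fun s => (z S - ε) * Real.exp (B * S) * Real.exp (-(B * s))) atTop
      (𝓝 ((z S - ε) * Real.exp (B * S) * 0)) :=
    ((Real.tendsto_exp_neg_atTop_nhds_zero.comp
      (tendsto_id.const_mul_atTop hB)).const_mul _)
  rw [mul_zero] at hlim
  filter_upwards [hlim.eventually_lt_const hε, eventually_ge_atTop S] with s h1 h2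
  have h3 : (z s - ε) * Real.exp (B * s) ≤ (z S - ε) * Real.exp (B * S) :=
    hanti (mem_Ici.mpr le_rfl) h2 h2
  have h4 := mul_le_mul_of_nonneg_right h3 (Real.exp_pos (-(B * s))).le
  rw [mul_assoc, ← Real.exp_add, add_neg_cancel, Real.exp_zero, mul_one] at h4
  linarith

theorem tendsto_zero_of_linear_ode {z e : ℝ → ℝ} {B : ℝ} (hB : 0 < B)
    (hz : ∀ s, HasDerivAt z (-(B * z s) + e s) s) (he : Tendsto e atTop (𝓝 0)) :
    Tendsto z atTop (𝓝 0) := by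
  rw [Metric.tendsto_nhds]
  intro ε hε
  have hz' : ∀ s, HasDerivAt (fun s => -z s) (-(B * -z s) + -e s) s := fun s =>
    (hz s).fun_neg.congr_deriv (by ring)
  have he' : Tendsto (fun s => -e s) atTop (𝓝 0) := by simpa using he.neg
  filter_upwards [eventually_le_of_linear_ode hB (half_pos hε) hz he,
    eventually_le_of_linear_ode hB (half_pos hε) hz' he'] with s h1 h2
  rw [Real.dist_eq, sub_zero, abs_lt]
  constructor <;> linarith

/-! ### Lyapunov function -/

/-- The derivative of the Lyapunov function in the scale-invariant Tolman-Oppenheimer-Volkoff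
system; here `A = 1 - x` and `κ y = (2 t + 1) A - 1`. -/
theorem lyapunov_identity {κ A t y x : ℝ} (hκ : 0 < κ) (hA : 0 < A) (ht : 0 ≤ t)
    (hx : x = 1 - A) (hy : y = ((2 * t + 1) * A - 1) / κ) :
    (2 + (1 + 6 * κ + κ ^ 2) / (2 * κ ^ 2)) / 2 * (-(y - x) / A)
      + (2 + (1 + 6 * κ + κ ^ 2) / (2 * κ ^ 2)) *
        ((1 + κ) * (((y - x) + κ * (y * (2 - (1 + κ) / κ * t))) / (2 * A) + t * (y - x) / A) /
          ((1 + κ) * t + (1 + 3 * κ)))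
      - (2 - (1 + κ) / κ * t) =
    -(2 * (1 + 3 * κ) * ((1 + κ) / (2 * κ)) ^ 2 * (t - 2 * κ / (1 + κ)) ^ 2 /
      ((1 + κ) * t + (1 + 3 * κ))) := by
  have hT : (1 + κ) * t + (1 + 3 * κ) ≠ 0 := by positivity
  have h1 : 1 + κ ≠ 0 := by positivity
  -- In the variables `t`, `A` the ratio `1/2` of the first two weights and the shift `1 + 3κ` make
  -- all `1/A` terms cancel. What remains vanishes at `t* = 2κ/(1+κ)`; the weight `N =
  -- (1+κ)(1+5κ)/(2κ²)`, written here as `2 + ...`, makes this zero double.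
  subst hx hy
  field_simp
  ring

/-- A Lyapunov function bounds trajectories of the scale-invariant system. -/
theorem bounds_of_lyapunov_le {κ N w x y t : ℝ} (hκ : 0 < κ) (hN : 1 < N) (hx0 : 0 ≤ x)
    (hx1 : x < 1) (hy : 0 < y) (ht : t = (x + κ * y) / (2 * (1 - x)))
    (hw : N / 2 * Real.log (1 - x) + N * Real.log ((1 + κ) * t + (1 + 3 * κ)) - Real.log y ≤ w) :
    Real.log y ≤ (w - N * Real.log (κ / 2)) / (N - 1) ∧
    (N * Real.log (1 / 2) - (w + (w - N * Real.log (κ / 2)) / (N - 1))) * (2 / N)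
      ≤ Real.log (1 - x) ∧
    N * Real.log (1 / 2) - (w - N * Real.log (κ / 2)) / (N - 1) ≤
      N / 2 * Real.log (1 - x) + N * Real.log ((1 + κ) * t + (1 + 3 * κ)) - Real.log y := by
  have hA : 0 < 1 - x := by linarith
  have ht0 : 0 ≤ t := by rw [ht]; positivity
  have hT : 0 < (1 + κ) * t + (1 + 3 * κ) := by positivity
  -- The right side is at least `1/2` and at least `κy/2`. Writing the Lyapunov function as `N
  -- log((1-x)T) - (N/2) log(1-x) - log y`, with `T = (1+κ)t + (1+3κ)`, the second bound controls
  -- `y` since `N > 1`, and the first then controls `1 - x` and gives a lower bound for the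
  -- function.
  have hAT : (1 - x) * ((1 + κ) * t + (1 + 3 * κ)) =
      (1 + κ) * (x + κ * y) / 2 + (1 + 3 * κ) * (1 - x) := by
    rw [ht]; field_simp
  have hκy : 0 < κ * y := mul_pos hκ hy
  have hlog : Real.log ((1 - x) * ((1 + κ) * t + (1 + 3 * κ))) =
      Real.log (1 - x) + Real.log ((1 + κ) * t + (1 + 3 * κ)) := Real.log_mul hA.ne' hT.ne'
  have l1 : Real.log (1 / 2) ≤ Real.log (1 - x) + Real.log ((1 + κ) * t + (1 + 3 * κ)) := by
    rw [← hlog, hAT]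
    apply Real.log_le_log (by norm_num)
    nlinarith [mul_nonneg hκ.le hx0, mul_pos hκ hκy, mul_pos hκ hA]
  have l2 : Real.log (κ / 2) + Real.log y ≤
      Real.log (1 - x) + Real.log ((1 + κ) * t + (1 + 3 * κ)) := by
    rw [← Real.log_mul (by positivity) hy.ne', ← hlog, hAT]
    apply Real.log_le_log (by positivity)
    nlinarith [mul_nonneg hκ.le hx0, mul_pos hκ hκy, mul_pos hκ hA]
  have l3 : Real.log (1 - x) ≤ 0 := Real.log_nonpos hA.le (by linarith)
  have hN0 : 0 < N := by linarith
  have b1 : Real.log y ≤ (w - N * Real.log (κ / 2)) / (N - 1) := by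
    rw [le_div_iff₀ (by linarith)]
    nlinarith [mul_le_mul_of_nonneg_left l2 hN0.le, mul_nonneg hN0.le (neg_nonneg.mpr l3)]
  refine ⟨b1, ?_, ?_⟩
  · generalize (w - N * Real.log (κ / 2)) / (N - 1) = q at *
    rw [mul_div_assoc', div_le_iff₀ hN0]
    nlinarith [mul_le_mul_of_nonneg_left l1 hN0.le]
  · nlinarith [mul_le_mul_of_nonneg_left l1 hN0.le, mul_nonneg hN0.le (neg_nonneg.mpr l3)]

/-! ### Convergence of the scale-invariant system -/

/-- The scale-invariant Tolman-Oppenheimer-Volkoff system with `p = κ ρ`. -/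
structure IsScaleInvariantTOV (κ : ℝ) (X Y : ℝ → ℝ) : Prop where
  nonneg : ∀ s, 0 ≤ X s
  lt_one : ∀ s, X s < 1
  pos : ∀ s, 0 < Y s
  hasDerivAt_fst : ∀ s, HasDerivAt X (Y s - X s) s
  hasDerivAt_snd : ∀ s, HasDerivAt Y
    (Y s * (2 - (1 + κ) / κ * ((X s + κ * Y s) / (2 * (1 - X s))))) s

/-- The gravitational slope `r ν'` in terms of the scale-invariant variables. -/
def slope (κ x y : ℝ) : ℝ := (x + κ * y) / (2 * (1 - x))

/-- The derivative of `slope` along the flow. -/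
def slopeDeriv (κ x y : ℝ) : ℝ :=
  ((y - x) + κ * (y * (2 - (1 + κ) / κ * slope κ x y))) / (2 * (1 - x))
    + slope κ x y * (y - x) / (1 - x)

theorem continuousOn_slope (κ : ℝ) :
    ContinuousOn (fun q : ℝ × ℝ => slope κ q.1 q.2) {q | q.1 < 1} := by
  unfold slope
  apply ContinuousOn.div (by fun_prop) (by fun_prop)
  rintro ⟨x, y⟩ (h : x < 1)
  have : 0 < 1 - x := by linarith
  positivity

theorem continuousOn_slopeDeriv (κ : ℝ) :
    ContinuousOn (fun q : ℝ × ℝ => slopeDeriv κ q.1 q.2) {q | q.1 < 1} := by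
  have h := continuousOn_slope κ
  have hA : ∀ q : ℝ × ℝ, q ∈ {q : ℝ × ℝ | q.1 < 1} → 1 - q.1 ≠ 0 := fun q (hq : q.1 < 1) =>
    (sub_pos.mpr hq).ne'
  unfold slopeDeriv
  apply ContinuousOn.add
  · exact ContinuousOn.div (by fun_prop) (by fun_prop) fun q hq => mul_ne_zero two_ne_zero (hA q hq)
  · exact ContinuousOn.div (by fun_prop) (by fun_prop) hA

/-- The Lyapunov function of the scale-invariant system. -/
def lyapunov (κ x y : ℝ) : ℝ :=
  (2 + (1 + 6 * κ + κ ^ 2) / (2 * κ ^ 2)) / 2 * Real.log (1 - x)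
    + (2 + (1 + 6 * κ + κ ^ 2) / (2 * κ ^ 2)) * Real.log ((1 + κ) * slope κ x y + (1 + 3 * κ))
    - Real.log y

namespace IsScaleInvariantTOV

variable {κ : ℝ} {X Y : ℝ → ℝ}

theorem slope_nonneg (h : IsScaleInvariantTOV κ X Y) (hκ : 0 < κ) (s : ℝ) : 0 ≤ slope κ (X s) (Y s) := by
  have h1 := h.nonneg s
  have h2 : 0 < 1 - X s := sub_pos.mpr (h.lt_one s)
  have h3 := h.pos s
  unfold slope
  positivity

theorem hasDerivAt_slope (h : IsScaleInvariantTOV κ X Y) (s : ℝ) :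
    HasDerivAt (fun s => slope κ (X s) (Y s)) (slopeDeriv κ (X s) (Y s)) s := by
  have h2 : 1 - X s ≠ 0 := (sub_pos.mpr (h.lt_one s)).ne'
  have hs := (h.hasDerivAt_fst s).fun_add ((h.hasDerivAt_snd s).const_mul κ)
  have := hs.fun_div (((h.hasDerivAt_fst s).const_sub 1).const_mul 2) (mul_ne_zero two_ne_zero h2)
  refine this.congr_deriv ?_
  unfold slopeDeriv slope
  field_simp
  ring

theorem hasDerivAt_lyapunov (h : IsScaleInvariantTOV κ X Y) (hκ : 0 < κ) (s : ℝ) :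
    HasDerivAt (fun s => lyapunov κ (X s) (Y s))
      (-(2 * (1 + 3 * κ) * ((1 + κ) / (2 * κ)) ^ 2 *
        (slope κ (X s) (Y s) - 2 * κ / (1 + κ)) ^ 2 /
          ((1 + κ) * slope κ (X s) (Y s) + (1 + 3 * κ)))) s := by
  have hA : 0 < 1 - X s := sub_pos.mpr (h.lt_one s)
  have ht := h.slope_nonneg hκ s
  have hY := h.pos s
  have hT : (1 + κ) * slope κ (X s) (Y s) + (1 + 3 * κ) ≠ 0 := by positivity
  have d1 := ((h.hasDerivAt_fst s).const_sub 1).log hA.ne'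
  have d2 := (((h.hasDerivAt_slope s).const_mul (1 + κ)).add_const (1 + 3 * κ)).log hT
  have d3 := (h.hasDerivAt_snd s).log hY.ne'
  have := ((d1.const_mul ((2 + (1 + 6 * κ + κ ^ 2) / (2 * κ ^ 2)) / 2)).fun_add
    (d2.const_mul (2 + (1 + 6 * κ + κ ^ 2) / (2 * κ ^ 2)))).fun_sub d3
  refine this.congr_deriv ?_
  have hy : Y s = ((2 * slope κ (X s) (Y s) + 1) * (1 - X s) - 1) / κ := by
    unfold slope
    field_simp
    ring
  rw [← lyapunov_identity hκ hA ht (by ring) hy, mul_div_cancel_left₀ _ hY.ne']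
  rfl

theorem tendsto_slope (h : IsScaleInvariantTOV κ X Y) (hκ : 0 < κ) :
    Tendsto (fun s => slope κ (X s) (Y s)) atTop (𝓝 (2 * κ / (1 + κ))) := by
  set N := 2 + (1 + 6 * κ + κ ^ 2) / (2 * κ ^ 2) with hN
  have hN1 : 1 < N := by
    have : 0 < (1 + 6 * κ + κ ^ 2) / (2 * κ ^ 2) := by positivity
    linarith
  have hanti : Antitone fun s => lyapunov κ (X s) (Y s) := by
    apply antitone_of_hasDerivAt_nonpos (h.hasDerivAt_lyapunov hκ)
    intro s
    have ht := h.slope_nonneg hκ s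
    simp only [Pi.zero_apply, Left.neg_nonpos_iff]
    positivity
  have hb := fun s (hs : 0 ≤ s) => bounds_of_lyapunov_le hκ hN1 (h.nonneg s) (h.lt_one s) (h.pos s)
    rfl (hanti hs)
  set w := lyapunov κ (X 0) (Y 0)
  set l := (w - N * Real.log (κ / 2)) / (N - 1)
  set v := (N * Real.log (1 / 2) - (w + l)) * (2 / N)
  -- The forward trajectory stays in a compact rectangle inside `X < 1`, where the slope and its
  -- derivative are bounded.
  have hK : ∀ s, 0 ≤ s → (X s, Y s) ∈ Icc 0 (1 - Real.exp v) ×ˢ Icc 0 (Real.exp l) :=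
    fun s hs => by
      obtain ⟨b1, b2, -⟩ := hb s hs
      rw [Real.le_log_iff_exp_le (sub_pos.mpr (h.lt_one s))] at b2
      exact ⟨⟨h.nonneg s, by linarith⟩, (h.pos s).le, (Real.log_le_iff_le_exp (h.pos s)).mp b1⟩
  have hsub : Icc 0 (1 - Real.exp v) ×ˢ Icc 0 (Real.exp l) ⊆ {q : ℝ × ℝ | q.1 < 1} :=
    fun q hq => by
      have h1 : q.1 ≤ 1 - Real.exp v := hq.1.2
      have h2 := Real.exp_pos v
      change q.1 < 1
      linarith
  have hcomp : IsCompact (Icc 0 (1 - Real.exp v) ×ˢ Icc (0 : ℝ) (Real.exp l)) :=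
    isCompact_Icc.prod isCompact_Icc
  obtain ⟨M, hM⟩ := hcomp.exists_bound_of_continuousOn ((continuousOn_slope κ).mono hsub)
  obtain ⟨L, hL⟩ := hcomp.exists_bound_of_continuousOn ((continuousOn_slopeDeriv κ).mono hsub)
  have hM0 : 0 ≤ M := (norm_nonneg _).trans (hM _ (hK 0 le_rfl))
  have key : Tendsto (fun s => slope κ (X s) (Y s) - 2 * κ / (1 + κ)) atTop (𝓝 0) := by
    refine tendsto_zero_of_dissipation
      (c := 2 * (1 + 3 * κ) * ((1 + κ) / (2 * κ)) ^ 2 / ((1 + κ) * M + (1 + 3 * κ)))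
      (by positivity) (fun s => (h.hasDerivAt_slope s).sub_const _) (fun s hs => hL _ (hK s hs))
      (h.hasDerivAt_lyapunov hκ) ?_ (fun s hs => (hb s hs).2.2)
    intro s hs
    have ht := h.slope_nonneg hκ s
    have htM : slope κ (X s) (Y s) ≤ M := (le_abs_self _).trans (hM _ (hK s hs))
    rw [neg_le_neg_iff, div_mul_eq_mul_div]
    gcongr
  simpa using key.add_const (2 * κ / (1 + κ))

theorem tendsto (h : IsScaleInvariantTOV κ X Y) (hκ : 0 < κ) :
    Tendsto X atTop (𝓝 (4 * κ / ((1 + κ) ^ 2 + 4 * κ))) ∧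
      Tendsto Y atTop (𝓝 (4 * κ / ((1 + κ) ^ 2 + 4 * κ))) := by
  set t := fun s => slope κ (X s) (Y s) with ht
  set α := 4 * κ / ((1 + κ) ^ 2 + 4 * κ) with hα
  have hlim : Tendsto t atTop (𝓝 (2 * κ / (1 + κ))) := h.tendsto_slope hκ
  have hy : ∀ s, Y s = ((2 * t s + 1) * (1 - X s) - 1) / κ := fun s => by
    have hA : 1 - X s ≠ 0 := (sub_pos.mpr (h.lt_one s)).ne'
    simp only [ht]
    unfold slope
    field_simp
    ring
  have hκ1 : 0 < 1 + κ := by positivity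
  have hfix : ((2 * (2 * κ / (1 + κ)) + 1) * (1 - α) - 1) / κ = α := by
    rw [hα]
    field_simp
    ring
  have he : Tendsto (fun s => 2 * (t s - 2 * κ / (1 + κ)) * (1 - X s) / κ) atTop (𝓝 0) := by
    have h0 : Tendsto (fun s => 2 * (t s - 2 * κ / (1 + κ)) / κ) atTop (𝓝 0) := by
      have := ((hlim.sub_const (2 * κ / (1 + κ))).const_mul 2).div_const κ
      simpa using this
    refine squeeze_zero_norm (fun s => ?_) (by simpa only [norm_zero] using h0.norm)
    have h1 : |1 - X s| ≤ 1 := by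
      rw [abs_le]
      constructor <;> linarith [h.nonneg s, h.lt_one s]
    rw [Real.norm_eq_abs, Real.norm_eq_abs, mul_div_right_comm, abs_mul]
    exact mul_le_of_le_one_right (abs_nonneg _) h1
  -- Eliminating `Y` in favor of `t` turns `X' = Y - X` into `(X - α)' = -B (X - α) + e`, with `B`
  -- evaluated at the limiting slope and `e` proportional to `(t - t*)(1 - X)`.
  have hX0 : Tendsto (fun s => X s - α) atTop (𝓝 0) := by
    refine tendsto_zero_of_linear_ode (B := (1 + 2 * (2 * κ / (1 + κ)) + κ) / κ)
      (by positivity) (fun s => ?_) he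
    refine ((h.hasDerivAt_fst s).sub_const α).congr_deriv ?_
    rw [hy s]
    have hα' : (1 + 2 * (2 * κ / (1 + κ)) + κ) * α = 2 * (2 * κ / (1 + κ)) := by
      rw [hα]
      field_simp
      ring
    generalize 2 * κ / (1 + κ) = q at *
    field_simp
    linear_combination -hα'
  have hX : Tendsto X atTop (𝓝 α) := by simpa using hX0.add_const α
  refine ⟨hX, ?_⟩
  have := ((((hlim.const_mul 2).add_const 1).mul (hX.const_sub 1)).sub_const 1).div_const κ
  rw [hfix] at this
  exact this.congr fun s => (hy s).symm

end IsScaleInvariantTOV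

/-! ### Eddington–Finkelstein coordinates and asymptotics -/

theorem partialDeriv_toEF {c h' : ℝ} {h : ℝ → ℝ} {x : Fin 4 → ℝ} (hh : HasDerivAt h h' (x 1))
    (μ α : Fin 4) : partialDeriv μ (fun y => toEF c h y α) x =
      if α = 0 then ![c, h', 0, 0] μ else if μ = α then 1 else 0 := by
  fin_cases μ <;> fin_cases α <;> simp [partialDeriv, toEF, hh.deriv]

/-- The `dt dr` term vanishes exactly when `h' = 1/(ab)`, and the `dt²` term requires `c b =
e^{ν+λ}`. The split `c = e^{ν₀}` is what normalizes `b` to `1` at the center when `ν → ν₀` and `λ →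
0`. -/
theorem pullback_efMetric {nu lam h : ℝ → ℝ} {ν₀ : ℝ} {x : Fin 4 → ℝ}
    (hh : HasDerivAt h (Real.exp (lam (x 1) - nu (x 1) + ν₀)) (x 1)) :
    pullback (toEF (Real.exp ν₀) h) (efMetric (fun r => Real.exp (-(2 * lam r)))
      (fun r => Real.exp (nu r + lam r - ν₀))) x = staticMetric nu lam x := by
  have e1 := Real.exp_ne_zero (nu (x 1))
  have e2 := Real.exp_ne_zero (lam (x 1))
  have e3 := Real.exp_ne_zero ν₀
  ext μ ν
  simp only [pullback, Matrix.of_apply, partialDeriv_toEF hh, Fin.sum_univ_four]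
  fin_cases μ <;> fin_cases ν <;>
    simp [efMetric, toEF, staticMetric, Real.exp_add, Real.exp_sub, Real.exp_neg, two_mul] <;>
    field_simp <;> ring

namespace IsStaticSolution

variable {k ρ₀ : ℝ} {nu lam ρ : ℝ → ℝ} {u : (Fin 4 → ℝ) → Fin 4 → ℝ}

/-- The linear equation of state has no intrinsic scale, so the equations become autonomous in `s =
log r`. -/
theorem isScaleInvariantTOV (hsol : IsStaticSolution k ρ₀ nu lam ρ u) (hk : 0 < k)
    (hρ₀ : 0 < ρ₀) : IsScaleInvariantTOV (k ^ 2)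
      (fun s => 1 - Real.exp (-(2 * lam (Real.exp s))))
      (fun s => 8 * Real.pi * Real.exp s ^ 2 * ρ (Real.exp s)) where
  nonneg s := by
    have h1 := hsol.massFunction_nonneg hk hρ₀ (Real.exp_pos s)
    rw [hsol.exp_lam_eq hk (Real.exp_pos s)]
    have : 0 ≤ 2 * massFunction ρ (Real.exp s) / Real.exp s := by positivity
    linarith
  lt_one s := by linarith [Real.exp_pos (-(2 * lam (Real.exp s)))]
  pos s := by
    have := hsol.density_pos hk hρ₀ (Real.exp_pos s)
    positivity
  hasDerivAt_fst s := by
    have hr := Real.exp_pos s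
    have := ((hsol.hasDerivAt_exp_lam hr).const_sub 1).comp s (Real.hasDerivAt_exp s)
    refine this.congr_deriv ?_
    linear_combination -(hsol.field_equations hr).1
  hasDerivAt_snd s := by
    have hr := Real.exp_pos s
    have hd := (((hasDerivAt_id' (Real.exp s)).fun_pow 2).const_mul (8 * Real.pi)).fun_mul
      (hsol.hasDerivAt_density hk hr)
    have := hd.comp s (Real.hasDerivAt_exp s)
    refine this.congr_deriv ?_
    have hE := Real.exp_ne_zero (-(2 * lam (Real.exp s)))
    -- The `rr` equation identifies the slope with `r ν'`; the Euler equation then gives the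
    -- equation for `Y`.
    have ht : (1 - Real.exp (-(2 * lam (Real.exp s)))
        + k ^ 2 * (8 * Real.pi * Real.exp s ^ 2 * ρ (Real.exp s))) /
        (2 * (1 - (1 - Real.exp (-(2 * lam (Real.exp s)))))) =
        Real.exp s * deriv nu (Real.exp s) := by
      rw [sub_sub_cancel, div_eq_iff (by positivity)]
      linear_combination (hsol.field_equations hr).2.1
    rw [ht]
    ring

theorem tendsto_atTop (hsol : IsStaticSolution k ρ₀ nu lam ρ u) (hk : 0 < k) (hρ₀ : 0 < ρ₀) :
    Tendsto (fun r => Real.exp (-(2 * lam r))) atTop (𝓝 (1 - deficitAngle k)) ∧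
      Tendsto (fun r => 8 * Real.pi * r ^ 2 * ρ r) atTop (𝓝 (deficitAngle k)) := by
  obtain ⟨hX, hY⟩ := (hsol.isScaleInvariantTOV hk hρ₀).tendsto (by positivity)
  constructor
  · refine ((hX.comp Real.tendsto_log_atTop).const_sub 1).congr' ?_
    filter_upwards [eventually_gt_atTop 0] with r hr
    simp [Real.exp_log hr]
  · refine (hY.comp Real.tendsto_log_atTop).congr' ?_
    filter_upwards [eventually_gt_atTop 0] with r hr
    simp [Real.exp_log hr]

theorem contDiffOn_advanced_time (hsol : IsStaticSolution k ρ₀ nu lam ρ u) {ν₀ : ℝ} {h : ℝ → ℝ}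
    (hh : ∀ r, 0 < r → HasDerivAt h (Real.exp (lam r - nu r + ν₀)) r) :
    ContDiffOn ℝ 3 h (Ioi 0) := by
  rw [show (3 : WithTop ℕ∞) = 2 + 1 by norm_num, contDiffOn_succ_iff_deriv_of_isOpen isOpen_Ioi]
  refine ⟨fun r hr => (hh r hr).differentiableAt.differentiableWithinAt, by simp, ?_⟩
  refine ContDiffOn.congr ?_ fun r hr => (hh r hr).deriv
  exact ((hsol.contDiffOn_lam.sub hsol.contDiffOn_nu).add contDiffOn_const).exp

end IsStaticSolution

theorem deficitAngle_mem {k : ℝ} (hk : 0 < k) : 0 < deficitAngle k ∧ deficitAngle k < 1 := by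
  unfold deficitAngle
  refine ⟨by positivity, ?_⟩
  rw [div_lt_one (by positivity)]
  have : 0 < (1 + k ^ 2) ^ 2 := by positivity
  linarith

/-- The metric coefficient `b` in terms of the scale-invariant density. -/
theorem rpow_mul_exp_eq {κ ρ₀ ν₀ n l r d : ℝ} (hκ : 0 < κ) (hρ₀ : 0 < ρ₀) (hr : 0 < r)
    (hd : d = ρ₀ * Real.exp (-((1 + κ) / κ * (n - ν₀)))) :
    r ^ (-(2 * κ / (1 + κ))) * Real.exp (n + l - ν₀) =
      (8 * Real.pi * ρ₀ / (8 * Real.pi * r ^ 2 * d)) ^ (κ / (1 + κ)) /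
        Real.sqrt (Real.exp (-(2 * l))) := by
  -- The density law makes this ratio `r⁻² e^{σ(n - ν₀)}` with `σ = (1+κ)/κ`; the power `κ/(1+κ) =
  -- 1/σ` recovers `e^{n - ν₀}` and produces `r^{-2κ/(1+κ)}`.
  have h1 : 8 * Real.pi * ρ₀ / (8 * Real.pi * r ^ 2 * d) =
      Real.exp (-2 * Real.log r + (1 + κ) / κ * (n - ν₀)) := by
    have hr2 : Real.exp (-2 * Real.log r) = (r ^ 2)⁻¹ := by
      rw [neg_mul, Real.exp_neg, mul_comm, Real.exp_mul, Real.exp_log hr, Real.rpow_two]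
    rw [Real.exp_add, hr2, hd, Real.exp_neg]
    have := Real.pi_ne_zero
    field_simp
  have h2 : Real.sqrt (Real.exp (-(2 * l))) = Real.exp (-l) := by
    rw [Real.sqrt_eq_iff_mul_self_eq (Real.exp_pos _).le (Real.exp_pos _).le, ← Real.exp_add]
    ring_nf
  rw [h1, h2, ← Real.exp_mul, ← Real.exp_sub, Real.rpow_def_of_pos hr, ← Real.exp_add]
  congr 1
  field_simp
  ring

end EinsteinEuler

end

theorem mainTheorem2 (k ρ₀ : ℝ) (hk₀ : 0 < k) (hk₁ : k < 1) (hρ₀ : 0 < ρ₀)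
    (nu lam ρ : ℝ → ℝ) (u : (Fin 4 → ℝ) → Fin 4 → ℝ)
    (hsol : EinsteinEuler.IsStaticSolution k ρ₀ nu lam ρ u) :
    ∃ (c : ℝ) (h a b : ℝ → ℝ),
      0 < c ∧ ContDiffOn ℝ 3 h (Set.Ioi 0) ∧
      Filter.Tendsto h (nhdsWithin 0 (Set.Ioi 0)) (nhds 0) ∧
      (∀ r : ℝ, 0 < r → a r = 1 - 2 * EinsteinEuler.massFunction ρ r / r) ∧
      (∀ r : ℝ, 0 < r → 0 < b r) ∧
      Filter.Tendsto b (nhdsWithin 0 (Set.Ioi 0)) (nhds 1) ∧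
      (∀ x ∈ EinsteinEuler.chart,
        EinsteinEuler.pullback (EinsteinEuler.toEF c h) (EinsteinEuler.efMetric a b) x =
          EinsteinEuler.staticMetric nu lam x) ∧
      Filter.Tendsto a Filter.atTop (nhds (1 - EinsteinEuler.deficitAngle k)) ∧
      Filter.Tendsto (fun r : ℝ => r ^ (-(2 * k ^ 2 / (1 + k ^ 2))) * b r) Filter.atTop
        (nhds ((8 * Real.pi * ρ₀ / EinsteinEuler.deficitAngle k) ^ (k ^ 2 / (1 + k ^ 2)) /
          Real.sqrt (1 - EinsteinEuler.deficitAngle k))) := by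
  obtain ⟨ν₀, hν₀, hρ⟩ := hsol.exists_density_eq hk₀ hρ₀
  obtain ⟨hα0, hα1⟩ := EinsteinEuler.deficitAngle_mem hk₀
  have hcont : ContinuousOn (fun s => Real.exp (lam s - nu s + ν₀)) (Ioi 0) :=
    ((hsol.contDiffOn_lam.continuousOn.sub hsol.contDiffOn_nu.continuousOn).add
      continuousOn_const).rexp
  have hlim : Tendsto (fun s => Real.exp (lam s - nu s + ν₀)) (𝓝[>] 0)
      (𝓝 (Real.exp (0 - ν₀ + ν₀))) := ((hsol.regular_center.sub hν₀).add_const ν₀).rexp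
  obtain ⟨hd, hz⟩ := EinsteinEuler.integral_from_center hcont hlim
  obtain ⟨ha, hy⟩ := hsol.tendsto_atTop hk₀ hρ₀
  refine ⟨Real.exp ν₀, fun r => ∫ s in (0 : ℝ)..r, Real.exp (lam s - nu s + ν₀),
    fun r => Real.exp (-(2 * lam r)), fun r => Real.exp (nu r + lam r - ν₀), Real.exp_pos _,
    hsol.contDiffOn_advanced_time hd, hz, fun r hr => hsol.exp_lam_eq hk₀ hr,
    fun r _ => Real.exp_pos _, ?_, fun x hx => EinsteinEuler.pullback_efMetric (hd _ hx.1), ha, ?_⟩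
  · have := ((hν₀.add hsol.regular_center).sub_const ν₀).rexp
    simpa using this
  · have hpow := ((tendsto_const_nhds (x := 8 * Real.pi * ρ₀)).div hy hα0.ne').rpow_const (p := k ^ 2 / (1 + k ^ 2))
      (Or.inr (by positivity))
    refine (hpow.div ha.sqrt (Real.sqrt_pos.mpr (sub_pos.mpr hα1)).ne').congr' ?_
    filter_upwards [eventually_gt_atTop 0] with r hr
    exact (EinsteinEuler.rpow_mul_exp_eq (by positivity) hρ₀ hr (hρ r hr)).symm
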